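/- Let $R$ be a commutative Noetherian ring with non-zero identity, $\mathfrak a$ an ideal of $R$, $M$ a finitely generated $R$-module, $X$ an arbitrary $R$-module, and for $i\ge 0$ let $$\mathrm H^i_{\mathfrak a}(M,X)=\varinjlim_{n\in\mathbb N}\mathrm{Ext}^i_R(M/\mathfrak a^nM,X)$$ be the $i$th generalized local cohomology module of $M$ and $X$ with respect to $\mathfrak a$. Let $t$ be a non-negative integer such that $\mathrm H^i_{\mathfrak a}(M,X)=0$ for all $i<t$. Then, for every finitely generated $R$-module $N$ that is $\mathfrak a$-torsion (i.e. each element of $N$ is annihilated by some power of $\mathfrak a$), there is an isomorphism of $R$-modules $$\mathrm{Hom}_R(N,\mathrm H^t_{\mathfrak a}(M,X))\cong\mathrm{Ext}^t_R(N\otimes_R M,X).$$ In particular, $\mathrm{Hom}_R(R/\mathfrak a,\mathrm H^t_{\mathfrak a}(M,X))\cong\mathrm{Ext}^t_R(M/\mathfrak aM,X)$ as $R$-modules, and $$\mathrm{Ass}_R\,\mathrm H^t_{\mathfrak a}(M,X)=\mathrm{Ass}_R\,\mathrm{Ext}^t_R(M/\mathfrak aM,X).$$ -/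

import Mathlib

universe u v

namespace GenLocalCohomology

open CategoryTheory

variable {R : Type u} [CommRing R] [Small.{v} R]

/-- `Ext^i_R(M, X)` as an `R`-module: Mathlib's `Ext` in the category of `R`-modules, with its
`R`-linear structure. -/
noncomputable abbrev ExtMod (R : Type u) [CommRing R] [Small.{v} R]
    (M X : Type v) [AddCommGroup M] [Module R M] [AddCommGroup X] [Module R X] (i : ℕ) : Type v :=
  Abelian.Ext (ModuleCat.of R M) (ModuleCat.of R X) i

/-- The map `Ext^i_R(M', X) → Ext^i_R(M, X)` induced by an `R`-linear map `f : M → M'`. -/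
noncomputable def extMap {M M' : Type v} [AddCommGroup M] [Module R M] [AddCommGroup M']
    [Module R M'] (f : M →ₗ[R] M') (X : Type v) [AddCommGroup X] [Module R X] (i : ℕ) :
    ExtMod R M' X i →ₗ[R] ExtMod R M X i :=
  Abelian.Ext.precompOfLinear (Abelian.Ext.mk₀ (ModuleCat.ofHom f)) R (ModuleCat.of R X)
    (zero_add i)

/-- The transition maps `Ext^i_R(M/𝔞^m M, X) → Ext^i_R(M/𝔞^n M, X)`, for `m ≤ n`, induced by the
natural projection `M/𝔞^n M → M/𝔞^m M`. -/
noncomputable def transition (𝔞 : Ideal R) (M X : Type v) [AddCommGroup M] [Module R M]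
    [AddCommGroup X] [Module R X] (i : ℕ) (m n : ℕ) (h : m ≤ n) :
    ExtMod R (M ⧸ (𝔞 ^ m • ⊤ : Submodule R M)) X i →ₗ[R]
      ExtMod R (M ⧸ (𝔞 ^ n • ⊤ : Submodule R M)) X i :=
  extMap (Submodule.factorPow 𝔞 M h) X i

/-- The modules `Ext^i_R(M/𝔞^n M, X)`, `n ∈ ℕ`, form a directed system. -/
instance directedSystem_transition (𝔞 : Ideal R) (M X : Type v) [AddCommGroup M] [Module R M]
    [AddCommGroup X] [Module R X] (i : ℕ) :
    DirectedSystem (fun n : ℕ => ExtMod R (M ⧸ (𝔞 ^ n • ⊤ : Submodule R M)) X i)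
      (fun m n h => transition 𝔞 M X i m n h) where
  map_self n x := by
    have h : Submodule.factorPow 𝔞 M (le_refl n) = LinearMap.id := by
      ext; rfl
    simp only [transition, extMap, h]
    exact Abelian.Ext.mk₀_id_comp x
  map_map k j n hij hjk x := by
    have h : Submodule.factorPow 𝔞 M (hij.trans hjk) =
        (Submodule.factorPow 𝔞 M hij).comp (Submodule.factorPow 𝔞 M hjk) := by
      ext; rfl
    simp only [transition, extMap, h, ModuleCat.ofHom_comp]
    exact Abelian.Ext.mk₀_comp_mk₀_assoc _ _ x

/-- The generalized local cohomology module
`H^i_𝔞(M, X) = colim_n Ext^i_R(M/𝔞^n M, X)` (an `R`-module). -/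
noncomputable abbrev H (𝔞 : Ideal R) (i : ℕ) (M X : Type v) [AddCommGroup M] [Module R M]
    [AddCommGroup X] [Module R X] : Type v :=
  Module.DirectLimit (fun n : ℕ => ExtMod R (M ⧸ (𝔞 ^ n • ⊤ : Submodule R M)) X i)
    (transition 𝔞 M X i)

/-- `N` is `𝔞`-torsion: every element of `N` is annihilated by some power of `𝔞`
(equivalently, `Γ_𝔞(N) = N`). -/
def IsIdealTorsion {R : Type u} [CommRing R] (𝔞 : Ideal R)
    (N : Type v) [AddCommGroup N] [Module R N] : Prop :=
  ∀ x : N, ∃ n : ℕ, ∀ r ∈ 𝔞 ^ n, r • x = 0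

end GenLocalCohomology

/-!
Write `Z = Supp M ∩ V(𝔞)`, the support of `M/𝔞M`, and consider finite modules supported in `Z`; each
`M/𝔞^n M`, and each `N ⊗ M` with `N` finite and `𝔞`-torsion, is one of them.

If `Ext^i(-, X)` vanishes on these modules for all `i < t`, then `Ext^t(-, X)` is left exact on
them. Its transition maps along `M/𝔞^n M → M/𝔞^m M` are then injective, so every `Ext^t(M/𝔞^n M, X)`
embeds in `H^t_𝔞(M, X)` (`ofExt_injective`). Hence if `H^t_𝔞(M, X) = 0`, then `Ext^t(M/𝔞M, X) = 0`,
and a dévissage over the support (`prop_of_support_subset`) spreads this vanishing to all finite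
modules supported in `Z`. By induction, the hypothesis `H^i_𝔞(M, X) = 0` for `i < t` gives
`Ext^i(L, X) = 0` for all `i < t` and all finite `L` supported in `Z`
(`extVanishesBelow_of_subsingleton`), so the left exactness is available in degree `t`.

For `N` killed by `𝔞^n`, restriction along `M/𝔞^n M → N ⊗ M`, `m ↦ x ⊗ m`, for `x ∈ N`, defines
`comparison : Ext^t(N ⊗ M, X) → Hom(N, H^t_𝔞(M, X))`. It is injective because these maps jointly
cover `N ⊗ M`. It is surjective because a homomorphism from `N` is given by finitely many classes on
`M/𝔞^m M`, for a common large `m`, and the relations between the generators of `N` are exactly what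
is needed to glue these classes to one on `N ⊗ M`.

Finally `N = R/𝔞` gives the second isomorphism, and the associated primes of the `𝔞`-torsion module
`H^t_𝔞(M, X)` are those of its submodule of elements killed by `𝔞`.
-/

namespace GenLocalCohomology

open CategoryTheory

/-! ### Dévissage over the support -/

section Devissage

variable {R : Type u} [CommRing R] [IsNoetherianRing R]

/-- A finite module has a nonzero linear map to `R ⧸ p` for every prime `p` of its support:
otherwise some element of its annihilator, hence of `p`, would be regular on `R ⧸ p`. -/
lemma exists_linearMap_ne_zero_of_mem_support {K L : Type v} [AddCommGroup K] [Module R K]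
    [Module.Finite R K] [AddCommGroup L] [Module R L] {p : PrimeSpectrum R}
    (hp : p ∈ Module.support R K) (e : L ≃ₗ[R] R ⧸ p.asIdeal) : ∃ f : K →ₗ[R] L, f ≠ 0 := by
  have : Module.Finite R L := Module.Finite.equiv e.symm
  by_contra! h
  have hs : Subsingleton (K →ₗ[R] L) := ⟨fun f g => (h f).trans (h g).symm⟩
  obtain ⟨r, hr, hreg⟩ := IsSMulRegular.subsingleton_linearMap_iff.mp hs
  have hrp : r ∈ p.asIdeal := Module.annihilator_le_of_mem_support hp hr
  have hzero (y : L) : r • y = 0 := by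
    apply e.injective
    obtain ⟨s, hs⟩ := Ideal.Quotient.mk_surjective (e y)
    rw [map_smul, map_zero, ← hs, ← Ideal.Quotient.mk_eq_mk, ← Submodule.Quotient.mk_smul,
      Submodule.Quotient.mk_eq_zero]
    exact Ideal.mul_mem_right s _ hrp
  have : Subsingleton L := ⟨fun x y => hreg (by simp only [hzero])⟩
  have : Subsingleton (R ⧸ p.asIdeal) := e.symm.toEquiv.subsingleton
  exact not_subsingleton _ this

/-- Dévissage along a prime filtration: a property of modules that passes to quotients and
extensions, inside the class of finite modules supported in `Z`, holds for such a module `L` as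
soon as it holds for the modules `R ⧸ p` with `p` in the support of `L`. -/
lemma prop_of_forall_quotient_prime {Z : Set (PrimeSpectrum R)}
    {P : ∀ (L : Type v) [AddCommGroup L] [Module R L], Prop}
    (hzero : ∀ (L : Type v) [AddCommGroup L] [Module R L] [Subsingleton L], P L)
    (hquot : ∀ (B C : Type v) [AddCommGroup B] [Module R B] [Module.Finite R B]
      [AddCommGroup C] [Module R C] (g : B →ₗ[R] C), Module.support R B ⊆ Z →
      Function.Surjective g → P B → P C)
    (hext : ∀ (B C : Type v) [AddCommGroup B] [Module R B] [Module.Finite R B]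
      [AddCommGroup C] [Module R C] (g : B →ₗ[R] C), Module.support R B ⊆ Z →
      Function.Surjective g → P (LinearMap.ker g) → P C → P B)
    (L : Type v) [AddCommGroup L] [Module R L] [Module.Finite R L]
    (hL : Module.support R L ⊆ Z)
    (hprime : ∀ p ∈ Module.support R L, ∀ (L' : Type v) [AddCommGroup L'] [Module R L'],
      (L' ≃ₗ[R] R ⧸ p.asIdeal) → P L') : P L := by
  induction ‹Module.Finite R L› using
    IsNoetherianRing.induction_on_isQuotientEquivQuotientPrime (A := R) with
  | subsingleton N => exact hzero N
  | quotient N p e =>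
    refine hprime p ?_ N e
    rw [Module.mem_support_iff_of_finite, e.annihilator_eq, Ideal.annihilator_quotient]
  | exact N₁ N₂ N₃ f g hf hg hfg ih₁ ih₃ =>
    have h₁ := Module.support_subset_of_injective f hf
    have h₃ := Module.support_subset_of_surjective g hg
    have p₁ := ih₁ (h₁.trans hL) fun p hp => hprime p (h₁ hp)
    have p₃ := ih₃ (h₃.trans hL) fun p hp => hprime p (h₃ hp)
    refine hext N₂ N₃ g hL hg ?_ p₃
    refine hquot N₁ (LinearMap.ker g) (f.codRestrict _ fun x => hfg.apply_apply_eq_zero x)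
      (h₁.trans hL) ?_ p₁
    rintro ⟨y, hy⟩
    obtain ⟨x, rfl⟩ := (hfg y).mp hy
    exact ⟨x, rfl⟩

/-- A property of modules that passes to quotients and extensions, inside the class of finite
modules supported in the support of a finite module `K`, holds on this whole class as soon as it
holds for `K`. -/
theorem prop_of_support_subset {K : Type v} [AddCommGroup K] [Module R K] [Module.Finite R K]
    {P : ∀ (L : Type v) [AddCommGroup L] [Module R L], Prop}
    (hquot : ∀ (B C : Type v) [AddCommGroup B] [Module R B] [Module.Finite R B]
      [AddCommGroup C] [Module R C] (g : B →ₗ[R] C),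
      Module.support R B ⊆ Module.support R K → Function.Surjective g → P B → P C)
    (hext : ∀ (B C : Type v) [AddCommGroup B] [Module R B] [Module.Finite R B]
      [AddCommGroup C] [Module R C] (g : B →ₗ[R] C),
      Module.support R B ⊆ Module.support R K → Function.Surjective g →
      P (LinearMap.ker g) → P C → P B)
    (hK : P K) (L : Type v) [AddCommGroup L] [Module R L] [Module.Finite R L]
    (hL : Module.support R L ⊆ Module.support R K) : P L := by
  have hzero (L : Type v) [AddCommGroup L] [Module R L] [Subsingleton L] : P L :=
    hquot K L 0 subset_rfl (fun y => ⟨0, Subsingleton.elim _ _⟩) hK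
  refine prop_of_forall_quotient_prime hzero hquot hext L hL fun p hp => ?_
  replace hp := hL hp
  -- Noetherian induction: the primes strictly containing `p` are already settled.
  obtain ⟨I, hI⟩ : ∃ I, I = p.asIdeal := ⟨_, rfl⟩
  induction I using WellFoundedGT.induction generalizing p with
  | ind I ih =>
  subst hI
  intro L' _ _ e
  have : Module.Finite R L' := Module.Finite.equiv e.symm
  have hann : Module.annihilator R L' = p.asIdeal := by
    rw [e.annihilator_eq, Ideal.annihilator_quotient]
  have hL' : Module.support R L' ⊆ Module.support R K := fun q hq =>
    Module.mem_support_mono (by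
      rw [Module.mem_support_iff_of_finite, hann] at hq
      exact hq) hp
  obtain ⟨f, hf⟩ := exists_linearMap_ne_zero_of_mem_support hp e
  refine hext L' (L' ⧸ LinearMap.range f) (LinearMap.range f).mkQ hL'
    (Submodule.mkQ_surjective _) ?_ ?_
  · rw [Submodule.ker_mkQ]
    exact hquot K (LinearMap.range f) f.rangeRestrict subset_rfl f.surjective_rangeRestrict hK
  · -- `R ⧸ p` modulo a nonzero ideal is supported at primes strictly containing `p`.
    have hsupp : Module.support R (L' ⧸ LinearMap.range f) ⊆ Module.support R L' :=
      Module.support_subset_of_surjective _ (Submodule.mkQ_surjective (LinearMap.range f))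
    refine prop_of_forall_quotient_prime hzero hquot hext _ (hsupp.trans hL') fun q hq => ?_
    refine ih q.asIdeal ?_ q (hL' (hsupp hq)) rfl
    have hpq : p.asIdeal ≤ q.asIdeal := by
      simpa only [Module.mem_support_iff_of_finite, hann] using hsupp hq
    obtain ⟨k, hk⟩ : ∃ k, f k ≠ 0 := by
      by_contra! h
      exact hf (LinearMap.ext h)
    obtain ⟨r, hr⟩ := Ideal.Quotient.mk_surjective (e (f k))
    have hrp : r ∉ p.asIdeal := fun h => hk (e.injective (by
      rw [map_zero, ← hr, Ideal.Quotient.eq_zero_iff_mem.mpr h]))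
    refine lt_of_le_of_ne hpq fun hEq => hrp (hEq ▸ ?_)
    rw [Module.mem_support_iff_of_finite] at hq
    refine hq (Module.mem_annihilator.mpr fun x => ?_)
    obtain ⟨l, rfl⟩ := Submodule.mkQ_surjective _ x
    obtain ⟨s, hs⟩ := Ideal.Quotient.mk_surjective (e l)
    rw [← map_smul, Submodule.mkQ_apply, Submodule.Quotient.mk_eq_zero]
    refine ⟨s • k, e.injective ?_⟩
    simp only [map_smul, ← hr, ← hs, ← Ideal.Quotient.mk_eq_mk, ← Submodule.Quotient.mk_smul,
      smul_eq_mul, mul_comm]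

end Devissage

/-! ### Ext as a contravariant functor on modules -/

section Ext

variable {R : Type u} [CommRing R] [Small.{v} R]
  {A B C : Type v} [AddCommGroup A] [Module R A] [AddCommGroup B] [Module R B]
  [AddCommGroup C] [Module R C] (X : Type v) [AddCommGroup X] [Module R X] (i : ℕ)

lemma extMap_id (x : ExtMod R A X i) : extMap LinearMap.id X i x = x :=
  Abelian.Ext.mk₀_id_comp x

lemma extMap_comp (f : A →ₗ[R] B) (g : B →ₗ[R] C) (x : ExtMod R C X i) :
    extMap (g ∘ₗ f) X i x = extMap f X i (extMap g X i x) :=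
  (Abelian.Ext.mk₀_comp_mk₀_assoc _ _ x).symm

lemma extMap_add (f g : A →ₗ[R] B) (x : ExtMod R B X i) :
    extMap (f + g) X i x = extMap f X i x + extMap g X i x := by
  simp only [extMap, ModuleCat.ofHom_add, Abelian.Ext.mk₀_add]
  exact Abelian.Ext.add_comp _ _ _ (zero_add i)

lemma extMap_smul (r : R) (f : A →ₗ[R] B) (x : ExtMod R B X i) :
    extMap (r • f) X i x = r • extMap f X i x := by
  have : ModuleCat.ofHom (r • f) = r • ModuleCat.ofHom f := rfl
  simp only [extMap, this, Abelian.Ext.mk₀_smul]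
  exact Abelian.Ext.smul_comp _ _ (zero_add i) _

/-- The map on `Ext` induced by a linear map, as a linear function of that map. -/
noncomputable def extMapLinear (x : ExtMod R B X i) : (A →ₗ[R] B) →ₗ[R] ExtMod R A X i where
  toFun f := extMap f X i x
  map_add' f g := extMap_add X i f g x
  map_smul' r f := extMap_smul X i r f x

lemma extMap_zero (x : ExtMod R B X i) : extMap (0 : A →ₗ[R] B) X i x = 0 :=
  map_zero (extMapLinear X i x)

lemma extMap_sum {ι : Type*} (s : Finset ι) (f : ι → A →ₗ[R] B) (x : ExtMod R B X i) :
    extMap (∑ j ∈ s, f j) X i x = ∑ j ∈ s, extMap (f j) X i x :=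
  map_sum (extMapLinear X i x) f s

/-- Scalars annihilating the first argument of `Ext` annihilate `Ext`. -/
lemma smul_ext_eq_zero {r : R} (hr : ∀ a : A, r • a = 0) (x : ExtMod R A X i) : r • x = 0 := by
  have : (r • LinearMap.id : A →ₗ[R] A) = 0 := LinearMap.ext hr
  rw [← extMap_id X i x, ← extMap_smul, this, extMap_zero]

variable {X i}

lemma exists_extMap_eq {g : B →ₗ[R] C} (hg : Function.Surjective g) (x : ExtMod R B X i)
    (hx : extMap (LinearMap.ker g).subtype X i x = 0) : ∃ y, extMap g X i y = x :=
  Abelian.Ext.contravariant_sequence_exact₂ (LinearMap.shortExact_shortComplexKer hg) _ x hx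

/-- If `Ext` of the kernel vanishes one degree below, then `Ext^i(-, X)` turns a surjection into an
injection. -/
lemma extMap_injective {g : B →ₗ[R] C} (hg : Function.Surjective g)
    (hker : ∀ j < i, Subsingleton (ExtMod R (LinearMap.ker g) X j)) :
    Function.Injective (extMap g X i) := by
  cases i with
  | zero =>
    have : Epi (ModuleCat.ofHom g) := (ModuleCat.epi_iff_surjective _).mpr hg
    exact Abelian.Ext.precomp_mk₀_injective_of_epi _ (ModuleCat.ofHom g)
  | succ j =>
    rw [← LinearMap.ker_eq_bot, LinearMap.ker_eq_bot']
    intro x hx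
    obtain ⟨y, hy⟩ := Abelian.Ext.contravariant_sequence_exact₃
      (LinearMap.shortExact_shortComplexKer hg) _ x hx (add_comm 1 j)
    have := hker j j.lt_succ_self
    rw [← hy, Subsingleton.elim (α := ExtMod R (LinearMap.ker g) X j) y 0]
    exact Abelian.Ext.comp_zero _ _ _ _ _

lemma subsingleton_ext_of_ker_of_codomain {g : B →ₗ[R] C} (hg : Function.Surjective g)
    (hker : Subsingleton (ExtMod R (LinearMap.ker g) X i))
    (hC : Subsingleton (ExtMod R C X i)) : Subsingleton (ExtMod R B X i) :=
  subsingleton_of_forall_eq 0 fun x => by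
    obtain ⟨y, rfl⟩ := exists_extMap_eq hg x (Subsingleton.elim _ _)
    rw [Subsingleton.elim y 0, map_zero]

variable (X i) in
/-- The isomorphism on `Ext` induced by an isomorphism of the first argument. -/
noncomputable def extCongr (e : A ≃ₗ[R] B) : ExtMod R B X i ≃ₗ[R] ExtMod R A X i :=
  LinearEquiv.ofLinearMap (extMap e.toLinearMap X i) (extMap e.symm.toLinearMap X i)
    (LinearMap.ext fun x => by
      rw [LinearMap.comp_apply, ← extMap_comp, LinearEquiv.symm_comp, extMap_id,
        LinearMap.id_apply])
    (LinearMap.ext fun x => by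
      rw [LinearMap.comp_apply, ← extMap_comp, LinearEquiv.comp_symm, extMap_id,
        LinearMap.id_apply])

end Ext

/-! ### Left exactness of Ext in the lowest degree -/

section Vanishing

variable {R : Type u} [CommRing R] [IsNoetherianRing R] [Small.{v} R]

/-- `Ext^i(L, X) = 0` for all `i < t` and all finite modules `L` supported in `Z`. -/
def ExtVanishesBelow (Z : Set (PrimeSpectrum R)) (X : Type v) [AddCommGroup X] [Module R X]
    (t : ℕ) : Prop :=
  ∀ i < t, ∀ (L : Type v) [AddCommGroup L] [Module R L] [Module.Finite R L],
    Module.support R L ⊆ Z → Subsingleton (ExtMod R L X i)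

variable {Z : Set (PrimeSpectrum R)} {X : Type v} [AddCommGroup X] [Module R X] {t : ℕ}

lemma ExtVanishesBelow.extMap_injective (h : ExtVanishesBelow Z X t)
    {B C : Type v} [AddCommGroup B] [Module R B] [Module.Finite R B] [AddCommGroup C] [Module R C]
    (hB : Module.support R B ⊆ Z) {g : B →ₗ[R] C} (hg : Function.Surjective g) :
    Function.Injective (extMap g X t) :=
  GenLocalCohomology.extMap_injective hg fun j hj => h j hj _
    ((Module.support_subset_of_injective _ (LinearMap.ker g).injective_subtype).trans hB)

/-- If `Ext^i(-, X)` vanishes below degree `t` on the finite modules supported in `Supp K` and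
`Ext^t(K, X) = 0`, then the vanishing extends to degree `t`. -/
lemma ExtVanishesBelow.succ {K : Type v} [AddCommGroup K] [Module R K] [Module.Finite R K]
    (h : ExtVanishesBelow (Module.support R K) X t) (hK : Subsingleton (ExtMod R K X t)) :
    ExtVanishesBelow (Module.support R K) X (t + 1) := by
  intro i hi L _ _ _ hL
  rcases Nat.lt_succ_iff_lt_or_eq.mp hi with hi | rfl
  · exact h i hi L hL
  · exact prop_of_support_subset (P := fun L _ _ => Subsingleton (ExtMod R L X i))
      (fun B C _ _ _ _ _ g hB hg hPB => (h.extMap_injective hB hg).subsingleton)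
      (fun B C _ _ _ _ _ g hB hg hker hC => subsingleton_ext_of_ker_of_codomain hg hker hC) hK L hL

/-- A class in the lowest degree is determined by its restrictions along linear maps `Q → A` whose
images together generate `A`. -/
lemma ExtVanishesBelow.eq_zero_of_span (h : ExtVanishesBelow Z X t)
    {Q A : Type v} [AddCommGroup Q] [Module R Q] [Module.Finite R Q] [AddCommGroup A] [Module R A]
    [Module.Finite R A] (hQ : Module.support R Q ⊆ Z) (x : ExtMod R A X t)
    (hx : Submodule.span R {a : A | ∃ f : Q →ₗ[R] A, extMap f X t x = 0 ∧ a ∈ LinearMap.range f} =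
      ⊤) : x = 0 := by
  obtain ⟨s, hs, hspan⟩ := (Submodule.fg_span_iff_fg_span_finset_subset _).mp
    (hx ▸ Module.Finite.fg_top (R := R) (M := A))
  choose f hf q hq using fun a : s => hs a.2
  let G : (s → Q) →ₗ[R] A := ∑ a, f a ∘ₗ LinearMap.proj a
  have hG : Function.Surjective G := by
    rw [← LinearMap.range_eq_top, ← top_le_iff, ← hx, hspan, Submodule.span_le]
    intro a ha
    classical
    refine ⟨Pi.single ⟨a, ha⟩ (q ⟨a, ha⟩), ?_⟩
    simp only [G, LinearMap.sum_apply, LinearMap.comp_apply, LinearMap.proj_apply]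
    rw [Finset.sum_eq_single ⟨a, ha⟩ (fun b _ hb => by rw [Pi.single_eq_of_ne hb, map_zero])
      (by simp), Pi.single_eq_same, hq]
  have hsupp : Module.support R (s → Q) ⊆ Z := by
    refine subset_trans (fun p hp => ?_) hQ
    rw [Module.mem_support_iff_of_finite] at hp ⊢
    exact fun r hr => hp (Module.mem_annihilator.mpr fun y => funext fun a =>
      Module.mem_annihilator.mp hr (y a))
  refine h.extMap_injective hsupp hG ?_
  simp only [G, extMap_sum, extMap_comp, hf, map_zero, Finset.sum_const_zero]

end Vanishing

/-! ### The maps `M/𝔞^n M → N ⊗ M` -/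

section TensorMap

variable {R : Type u} [CommRing R] {𝔞 : Ideal R} {M : Type v} [AddCommGroup M] [Module R M]

lemma support_quotient_pow_subset [Module.Finite R M] (n : ℕ) :
    Module.support R (M ⧸ (𝔞 ^ n • ⊤ : Submodule R M)) ⊆
      Module.support R M ∩ PrimeSpectrum.zeroLocus 𝔞 := by
  rw [Module.support_quotient]
  refine Set.inter_subset_inter_right _ fun p hp => ?_
  exact p.isPrime.le_of_pow_le hp

variable {N : Type v} [AddCommGroup N] [Module R N] {n : ℕ}

variable (M) in
/-- For `N` killed by `𝔞^n`, the element `x : N` gives the map `M/𝔞^n M → N ⊗ M` sending the class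
of `m` to `x ⊗ m`. -/
noncomputable def tensorMap (hn : ∀ r ∈ 𝔞 ^ n, ∀ x : N, r • x = 0) :
    N →ₗ[R] (M ⧸ (𝔞 ^ n • ⊤ : Submodule R M)) →ₗ[R] TensorProduct R N M where
  toFun x := (𝔞 ^ n • ⊤ : Submodule R M).liftQ (TensorProduct.mk R N M x) (by
    rw [Submodule.smul_le]
    intro r hr m _
    rw [LinearMap.mem_ker, TensorProduct.mk_apply, TensorProduct.tmul_smul,
      TensorProduct.smul_tmul', hn r hr, TensorProduct.zero_tmul])
  map_add' x y := by
    ext m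
    exact TensorProduct.add_tmul x y m
  map_smul' r x := by
    ext m
    exact TensorProduct.smul_tmul' r x m

lemma tensorMap_mkQ (hn : ∀ r ∈ 𝔞 ^ n, ∀ x : N, r • x = 0) (x : N) (m : M) :
    tensorMap M hn x (Submodule.mkQ _ m) = TensorProduct.tmul R x m := rfl

end TensorMap

/-! ### Generalized local cohomology in the lowest degree -/

section LocalCohomology

variable {R : Type u} [CommRing R] [Small.{v} R] {𝔞 : Ideal R}
  {M X : Type v} [AddCommGroup M] [Module R M] [AddCommGroup X] [Module R X] {t : ℕ}

variable (𝔞 M X t) in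
/-- The canonical map `Ext^t(M/𝔞^n M, X) → H^t_𝔞(M, X)`. -/
noncomputable abbrev ofExt (n : ℕ) :
    ExtMod R (M ⧸ (𝔞 ^ n • ⊤ : Submodule R M)) X t →ₗ[R] H 𝔞 t M X :=
  Module.DirectLimit.of R ℕ (fun n : ℕ => ExtMod R (M ⧸ (𝔞 ^ n • ⊤ : Submodule R M)) X t)
    (transition 𝔞 M X t) n

lemma ofExt_transition {m n : ℕ} (h : m ≤ n)
    (x : ExtMod R (M ⧸ (𝔞 ^ m • ⊤ : Submodule R M)) X t) :
    ofExt 𝔞 M X t n (transition 𝔞 M X t m n h x) = ofExt 𝔞 M X t m x :=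
  Module.DirectLimit.of_f

lemma exists_pow_smul_eq_zero (h : H 𝔞 t M X) : ∃ n : ℕ, ∀ r ∈ 𝔞 ^ n, r • h = 0 := by
  obtain ⟨n, x, rfl⟩ := Module.DirectLimit.exists_of h
  refine ⟨n, fun r hr => ?_⟩
  rw [← map_smul, smul_ext_eq_zero, map_zero]
  intro a
  obtain ⟨m, rfl⟩ := Submodule.mkQ_surjective _ a
  rw [← map_smul, Submodule.mkQ_apply, Submodule.Quotient.mk_eq_zero]
  exact Submodule.smul_mem_smul hr trivial

variable [IsNoetherianRing R] [Module.Finite R M]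

lemma ofExt_injective
    (h : ExtVanishesBelow (Module.support R M ∩ PrimeSpectrum.zeroLocus 𝔞) X t) (n : ℕ) :
    Function.Injective (ofExt 𝔞 M X t n) := by
  rw [← LinearMap.ker_eq_bot, LinearMap.ker_eq_bot']
  intro x hx
  obtain ⟨m, hm, hxm⟩ := Module.DirectLimit.of.zero_exact hx
  refine h.extMap_injective (support_quotient_pow_subset m)
    (g := Submodule.factorPow 𝔞 M hm) (Submodule.factor_surjective _) ?_
  rw [map_zero]
  exact hxm

/-- Vanishing of `H^i_𝔞(M, X)` below degree `t` forces vanishing of `Ext^i(L, X)` below degree `t`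
for every finite module `L` supported in `Supp M ∩ V(𝔞)`. -/
theorem extVanishesBelow_of_subsingleton
    (hvanish : ∀ i < t, Subsingleton (H 𝔞 i M X)) :
    ExtVanishesBelow (Module.support R M ∩ PrimeSpectrum.zeroLocus 𝔞) X t := by
  induction t with
  | zero => exact fun i hi => absurd hi (Nat.not_lt_zero i)
  | succ t ih =>
    have h := ih fun i hi => hvanish i (hi.trans t.lt_succ_self)
    have hH := hvanish t t.lt_succ_self
    have hsupp : Module.support R M ∩ PrimeSpectrum.zeroLocus 𝔞 =
        Module.support R (M ⧸ (𝔞 ^ 1 • ⊤ : Submodule R M)) := by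
      rw [Module.support_quotient, pow_one]
    have hinj := ofExt_injective h 1
    rw [hsupp] at h ⊢
    exact h.succ hinj.subsingleton

end LocalCohomology

/-! ### The comparison map -/

section Comparison

variable {R : Type u} [CommRing R] [Small.{v} R] {𝔞 : Ideal R}
  {M N X : Type v} [AddCommGroup M] [Module R M] [AddCommGroup N] [Module R N]
  [AddCommGroup X] [Module R X] {t n : ℕ}

variable (M X t) in
/-- The comparison map `Ext^t(N ⊗ M, X) → Hom(N, H^t_𝔞(M, X))` for `N` killed by `𝔞^n`: a class is
sent to the function of `x : N` that restricts it along `M/𝔞^n M → N ⊗ M`, `m ↦ x ⊗ m`. -/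
noncomputable def comparison (hn : ∀ r ∈ 𝔞 ^ n, ∀ x : N, r • x = 0) :
    ExtMod R (TensorProduct R N M) X t →ₗ[R] N →ₗ[R] H 𝔞 t M X where
  toFun ξ := ofExt 𝔞 M X t n ∘ₗ extMapLinear X t ξ ∘ₗ tensorMap M hn
  map_add' ξ η := LinearMap.ext fun x => by
    simp [extMapLinear]
  map_smul' r ξ := LinearMap.ext fun x => by
    simp [extMapLinear]

lemma comparison_apply (hn : ∀ r ∈ 𝔞 ^ n, ∀ x : N, r • x = 0)
    (ξ : ExtMod R (TensorProduct R N M) X t) (x : N) :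
    comparison M X t hn ξ x = ofExt 𝔞 M X t n (extMap (tensorMap M hn x) X t ξ) := rfl

/-- The comparison map does not depend on the power of `𝔞` used to define it. -/
lemma comparison_eq_of_le {m : ℕ} (hn : ∀ r ∈ 𝔞 ^ n, ∀ x : N, r • x = 0) (h : n ≤ m)
    (hm : ∀ r ∈ 𝔞 ^ m, ∀ x : N, r • x = 0) : comparison M X t hn = comparison M X t hm := by
  have hfactor (x : N) :
      tensorMap M hn x ∘ₗ Submodule.factorPow 𝔞 M h = tensorMap M hm x := by
    ext y
    rfl
  ext ξ x
  rw [comparison_apply, comparison_apply, ← ofExt_transition h, transition, ← extMap_comp, hfactor]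

variable [IsNoetherianRing R] [Module.Finite R M]

lemma comparison_injective
    (h : ExtVanishesBelow (Module.support R M ∩ PrimeSpectrum.zeroLocus 𝔞) X t)
    [Module.Finite R N] (hn : ∀ r ∈ 𝔞 ^ n, ∀ x : N, r • x = 0) :
    Function.Injective (comparison M X t hn) := by
  rw [← LinearMap.ker_eq_bot, LinearMap.ker_eq_bot']
  intro ξ hξ
  refine h.eq_zero_of_span (support_quotient_pow_subset n) ξ ?_
  rw [← top_le_iff, ← TensorProduct.span_tmul_eq_top, Submodule.span_le]
  rintro _ ⟨x, m, rfl⟩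
  refine Submodule.subset_span ⟨tensorMap M hn x, ofExt_injective h n ?_, Submodule.mkQ _ m,
    tensorMap_mkQ hn x m⟩
  rw [map_zero, ← comparison_apply, hξ, LinearMap.zero_apply]

/-- The comparison map is surjective. A homomorphism `N → H^t_𝔞(M, X)` has finitely generated
image, hence takes values in `Ext^t(M/𝔞^m M, X)` for `m` large; its values on generators
`x₁, …, x_k` define a class on `(M/𝔞^m M)^k`, and this class descends along the surjection onto
`N ⊗ M` because, by the equational criterion for vanishing in a tensor product, the kernel of that
surjection is generated by the vectors `(a₁ y, …, a_k y)` with `∑ a_i x_i = 0`. -/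
lemma comparison_surjective
    (h : ExtVanishesBelow (Module.support R M ∩ PrimeSpectrum.zeroLocus 𝔞) X t)
    [Module.Finite R N] (hn : ∀ r ∈ 𝔞 ^ n, ∀ x : N, r • x = 0) :
    Function.Surjective (comparison M X t hn) := by
  intro φ
  obtain ⟨k, x, hx⟩ := Module.Finite.exists_fin (R := R) (M := N)
  obtain ⟨m, hnm, ζ, hζ⟩ : ∃ m, n ≤ m ∧ ∃ ζ : Fin k →
      ExtMod R (M ⧸ (𝔞 ^ m • ⊤ : Submodule R M)) X t, ∀ i, ofExt 𝔞 M X t m (ζ i) = φ (x i) := by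
    choose d z hz using fun i => Module.DirectLimit.exists_of (φ (x i))
    have hd (i : Fin k) : d i ≤ n + ∑ j, d j :=
      (Finset.single_le_sum (fun _ _ => Nat.zero_le _) (Finset.mem_univ i)).trans
        (Nat.le_add_left _ _)
    exact ⟨n + ∑ j, d j, Nat.le_add_right _ _, fun i => transition 𝔞 M X t _ _ (hd i) (z i),
      fun i => (ofExt_transition (hd i) (z i)).trans (hz i)⟩
  have hm : ∀ r ∈ 𝔞 ^ m, ∀ y : N, r • y = 0 := fun r hr => hn r (Ideal.pow_le_pow_right hnm hr)
  rw [comparison_eq_of_le hn hnm hm]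
  let Q := M ⧸ (𝔞 ^ m • ⊤ : Submodule R M)
  let G : (Fin k → Q) →ₗ[R] TensorProduct R N M := ∑ i, tensorMap M hm (x i) ∘ₗ LinearMap.proj i
  have hGsingle (i : Fin k) : G ∘ₗ LinearMap.single R (fun _ => Q) i = tensorMap M hm (x i) := by
    ext y
    simp only [G, LinearMap.comp_apply, LinearMap.sum_apply, LinearMap.proj_apply,
      LinearMap.single_apply]
    rw [Finset.sum_eq_single i (fun b _ hb => by rw [Pi.single_eq_of_ne hb, map_zero])
      (by simp), Pi.single_eq_same]
  have hG : Function.Surjective G := by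
    rw [← LinearMap.range_eq_top, ← top_le_iff, ← TensorProduct.span_tmul_eq_top,
      Submodule.span_le]
    rintro _ ⟨y, l, rfl⟩
    have hy : y ∈ (LinearMap.range G).comap ((TensorProduct.mk R N M).flip l) := by
      have : (⊤ : Submodule R N) ≤ (LinearMap.range G).comap ((TensorProduct.mk R N M).flip l) := by
        rw [← hx, Submodule.span_le]
        rintro _ ⟨i, rfl⟩
        exact ⟨LinearMap.single R (fun _ => Q) i (Submodule.mkQ _ l),
          LinearMap.congr_fun (hGsingle i) _⟩
      exact this trivial
    exact hy
  let z : ExtMod R (Fin k → Q) X t := ∑ i, extMap (LinearMap.proj i) X t (ζ i)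
  have hz : extMap (LinearMap.ker G).subtype X t z = 0 := by
    refine h.eq_zero_of_span (support_quotient_pow_subset m) _ (top_le_iff.mp ?_)
    rintro ⟨q, hq⟩ -
    choose l hl using fun i => Submodule.mkQ_surjective _ (q i)
    have hrel : ∑ i, TensorProduct.tmul R (x i) (l i) = 0 := by
      rw [← LinearMap.mem_ker.mp hq]
      simp only [G, LinearMap.sum_apply, LinearMap.comp_apply, LinearMap.proj_apply, ← hl,
        tensorMap_mkQ]
    obtain ⟨c, a, y, hay, ha⟩ := TensorProduct.vanishesTrivially_of_sum_tmul_eq_zero R hx hrel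
    -- `A j` is the relation map `y ↦ (a₁ⱼ y, …, a_kⱼ y)` into the kernel of `G`.
    let A (j : Fin c) : Q →ₗ[R] LinearMap.ker G :=
      (LinearMap.pi fun i => a i j • LinearMap.id).codRestrict _ fun w => by
        obtain ⟨w, rfl⟩ := Submodule.mkQ_surjective _ w
        simp only [LinearMap.mem_ker, G, LinearMap.sum_apply, LinearMap.comp_apply,
          LinearMap.proj_apply, LinearMap.pi_apply, LinearMap.smul_apply, LinearMap.id_apply,
          map_smul, tensorMap_mkQ]
        simp only [TensorProduct.smul_tmul', ← TensorProduct.sum_tmul, ha,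
          TensorProduct.zero_tmul]
    have hproj (i : Fin k) (j : Fin c) :
        LinearMap.proj i ∘ₗ (LinearMap.ker G).subtype ∘ₗ A j = a i j • LinearMap.id := rfl
    have hA (j : Fin c) : extMap (A j) X t (extMap (LinearMap.ker G).subtype X t z) = 0 := by
      rw [← extMap_comp]
      apply ofExt_injective h m
      simp only [z, map_sum, ← extMap_comp, hproj, extMap_smul, extMap_id, map_smul, hζ]
      simp only [← map_smul, ← map_sum, ha, map_zero]
    have hsum : (⟨q, hq⟩ : LinearMap.ker G) = ∑ j, A j (Submodule.mkQ _ (y j)) := by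
      apply Subtype.ext
      funext i
      change q i = _
      rw [← hl i, hay i, map_sum, AddSubmonoidClass.coe_finsetSum, Finset.sum_apply]
      simp only [map_smul]
      rfl
    rw [hsum]
    exact Submodule.sum_mem _ fun j _ => Submodule.subset_span ⟨A j, hA j, _, rfl⟩
  obtain ⟨ξ, hξ⟩ := exists_extMap_eq hG z hz
  refine ⟨ξ, LinearMap.ext_on_range hx fun i => ?_⟩
  rw [comparison_apply, ← hζ i, ← hGsingle i, extMap_comp, hξ]
  congr 1
  simp only [z, map_sum, ← extMap_comp]
  rw [Finset.sum_eq_single i]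
  · rw [LinearMap.proj_comp_single_same, extMap_id]
  · intro j _ hj
    rw [LinearMap.proj_comp_single_ne _ _ _ _ hj, extMap_zero]
  · simp

end Comparison

/-! ### Torsion modules and associated primes -/

section Torsion

variable {R : Type u} [CommRing R] {𝔞 : Ideal R}

lemma IsIdealTorsion.exists_pow_smul_eq_zero {N : Type v} [AddCommGroup N] [Module R N]
    [Module.Finite R N] (hN : IsIdealTorsion 𝔞 N) :
    ∃ n : ℕ, ∀ r ∈ 𝔞 ^ n, ∀ x : N, r • x = 0 := by
  obtain ⟨k, x, hx⟩ := Module.Finite.exists_fin (R := R) (M := N)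
  choose d hd using fun i => hN (x i)
  refine ⟨∑ j, d j, fun r hr y => ?_⟩
  have : r • (LinearMap.id : N →ₗ[R] N) = 0 := LinearMap.ext_on_range hx fun i =>
    hd i r (Ideal.pow_le_pow_right
      (Finset.single_le_sum (fun _ _ => Nat.zero_le _) (Finset.mem_univ i)) hr)
  exact LinearMap.congr_fun this y

/-- An associated prime of an `𝔞`-torsion module contains `𝔞`, so it is the annihilator of an
element of the submodule `Hom(R/𝔞, H)` of elements killed by `𝔞`. -/
lemma IsIdealTorsion.associatedPrimes_linearMap_quotient [IsNoetherianRing R] {H : Type v}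
    [AddCommGroup H] [Module R H]
    (hH : IsIdealTorsion 𝔞 H) :
    associatedPrimes R ((R ⧸ 𝔞) →ₗ[R] H) = associatedPrimes R H := by
  have hinj : Function.Injective
      (LinearMap.applyₗ (R := R) (M₂ := H) (1 : R ⧸ 𝔞)) := fun f g hfg => by
    apply Submodule.linearMap_qext
    ext
    exact hfg
  refine Set.Subset.antisymm (associatedPrimes.subset_of_injective hinj) fun p hp => ?_
  obtain ⟨hprime, x, hx⟩ := isAssociatedPrime_iff.mp hp
  have hmem (r : R) : r ∈ p ↔ r • x = 0 := by
    rw [hx, Submodule.mem_colon_singleton, Submodule.mem_bot]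
  obtain ⟨n, hn⟩ := hH x
  have hle : 𝔞 ≤ p := hprime.le_of_pow_le fun r hr => (hmem r).mpr (hn r hr)
  let g : (R ⧸ 𝔞) →ₗ[R] H := Submodule.liftQ 𝔞 (LinearMap.toSpanSingleton R H x) fun r hr =>
    (hmem r).mp (hle hr)
  have hg : LinearMap.applyₗ (R := R) (M₂ := H) (1 : R ⧸ 𝔞) g = x := one_smul R x
  refine isAssociatedPrime_iff.mpr ⟨hprime, g, ?_⟩
  ext r
  rw [hmem, Submodule.mem_colon_singleton, Submodule.mem_bot, ← hinj.eq_iff, map_smul, hg, map_zero]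

end Torsion

end GenLocalCohomology

theorem corollary2p8 {R : Type u} [CommRing R] [Nontrivial R] [IsNoetherianRing R] [Small.{v} R]
    (𝔞 : Ideal R)
    (M : Type v) [AddCommGroup M] [Module R M] [Module.Finite R M]
    (X : Type v) [AddCommGroup X] [Module R X]
    (t : ℕ) (hvanish : ∀ i < t, Subsingleton (GenLocalCohomology.H 𝔞 i M X)) :
    (∀ (N : Type v) [AddCommGroup N] [Module R N] [Module.Finite R N],
      GenLocalCohomology.IsIdealTorsion 𝔞 N →
        Nonempty ((N →ₗ[R] GenLocalCohomology.H 𝔞 t M X) ≃ₗ[R]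
          GenLocalCohomology.ExtMod R (TensorProduct R N M) X t)) ∧
    Nonempty (((R ⧸ 𝔞) →ₗ[R] GenLocalCohomology.H 𝔞 t M X) ≃ₗ[R]
      GenLocalCohomology.ExtMod R (M ⧸ (𝔞 • ⊤ : Submodule R M)) X t) ∧
    associatedPrimes R (GenLocalCohomology.H 𝔞 t M X) =
      associatedPrimes R
        (GenLocalCohomology.ExtMod R (M ⧸ (𝔞 • ⊤ : Submodule R M)) X t) := by
  have hvan := GenLocalCohomology.extVanishesBelow_of_subsingleton hvanish
  have hiso : ∀ (N : Type v) [AddCommGroup N] [Module R N] [Module.Finite R N],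
      GenLocalCohomology.IsIdealTorsion 𝔞 N →
        Nonempty ((N →ₗ[R] GenLocalCohomology.H 𝔞 t M X) ≃ₗ[R]
          GenLocalCohomology.ExtMod R (TensorProduct R N M) X t) := by
    intro N _ _ _ hN
    obtain ⟨n, hn⟩ := hN.exists_pow_smul_eq_zero
    exact ⟨(LinearEquiv.ofBijective (GenLocalCohomology.comparison M X t hn)
      ⟨GenLocalCohomology.comparison_injective hvan hn,
        GenLocalCohomology.comparison_surjective hvan hn⟩).symm⟩
  -- `R ⧸ 𝔞` need not live in the universe of `M` and `X`; its shrinking does.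
  let e : Shrink.{v} (R ⧸ 𝔞) ≃ₗ[R] R ⧸ 𝔞 := Shrink.linearEquiv R (R ⧸ 𝔞)
  have : Module.Finite R (Shrink.{v} (R ⧸ 𝔞)) := Module.Finite.equiv e.symm
  have htors : GenLocalCohomology.IsIdealTorsion 𝔞 (Shrink.{v} (R ⧸ 𝔞)) := by
    refine fun x => ⟨1, fun r hr => e.injective ?_⟩
    obtain ⟨s, hs⟩ := Ideal.Quotient.mk_surjective (e x)
    rw [map_smul, map_zero, ← hs, ← Ideal.Quotient.mk_eq_mk, ← Submodule.Quotient.mk_smul,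
      Submodule.Quotient.mk_eq_zero]
    exact Ideal.mul_mem_right s _ (pow_one 𝔞 ▸ hr)
  obtain ⟨f⟩ := hiso _ htors
  let φ : ((R ⧸ 𝔞) →ₗ[R] GenLocalCohomology.H 𝔞 t M X) ≃ₗ[R]
      GenLocalCohomology.ExtMod R (M ⧸ (𝔞 • ⊤ : Submodule R M)) X t :=
    e.symm.arrowCongr (LinearEquiv.refl R _) ≪≫ₗ f ≪≫ₗ
      (GenLocalCohomology.extCongr X t (TensorProduct.congr e (LinearEquiv.refl R M) ≪≫ₗ
        TensorProduct.quotTensorEquivQuotSMul M 𝔞)).symm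
  have hH : GenLocalCohomology.IsIdealTorsion 𝔞 (GenLocalCohomology.H 𝔞 t M X) :=
    GenLocalCohomology.exists_pow_smul_eq_zero
  exact ⟨hiso, ⟨φ⟩,
    hH.associatedPrimes_linearMap_quotient.symm.trans (LinearEquiv.AssociatedPrimes.eq φ)⟩
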